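/- Let $z^1,\dots,z^N\in\mathbb{R}^p$, $y_1,\dots,y_N\in\{-1,1\}$ and $\lambda>0$, let $X$ be the $N\times p$ matrix with $i$-th row $(z^i)^T$, and let $$Q_{\rm logit}(\beta)=\sum_{i=1}^N\log\left(1+e^{-y_i\beta^Tz^i}\right)+\lambda\sum_{j=1}^p|\beta_j|,\qquad \beta\in\mathbb{R}^p .$$ Suppose that $X$ has no zero column. Then for every $\beta\in\mathbb{R}^p$ and every $j\in\{1,\dots,p\}$ the function $Q_{\rm logit}$ has exactly one minimizer on the set of all vectors that agree with $\beta$ in every coordinate other than the $j$-th, so that cyclic coordinatewise minimization is well defined. Moreover, let $(\beta^r)_{r\ge 0}$ be its sequence of iterates from an arbitrary starting point $\beta^0\in\mathbb{R}^p$: $\beta^{r,0}=\beta^r$, for $i=1,\dots,p$ the vector $\beta^{r,i}$ minimizes $Q_{\rm logit}$ over all vectors that agree with $\beta^{r,i-1}$ in every coordinate other than the $i$-th, and $\beta^{r+1}=\beta^{r,p}$. Then $(\beta^r)_{r\ge 0}$ converges to some $\beta^*\in\mathbb{R}^p$, and $Q_{\rm logit}(\beta^*)\le Q_{\rm logit}(\beta)$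 for every $\beta\in\mathbb{R}^p$. -/

import Mathlib

open Filter Topology
open scoped Matrix

noncomputable section

/-- The `N × p` design matrix `X`, whose `i`-th row is `(zⁱ)ᵀ`. -/
def designMatrix {N p : ℕ} (z : Fin N → (Fin p → ℝ)) : Matrix (Fin N) (Fin p) ℝ :=
  Matrix.of z

/-- The objective of `ℓ₁`-penalized logistic regression,
`Q(β) = ∑ i, log (1 + exp (- yᵢ βᵀ zⁱ)) + lam * ∑ j, |βⱼ|`. -/
def Qlogit {N p : ℕ} (z : Fin N → (Fin p → ℝ)) (y : Fin N → ℝ) (lam : ℝ)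
    (β : Fin p → ℝ) : ℝ :=
  (∑ i, Real.log (1 + Real.exp (-(y i * (β ⬝ᵥ z i))))) + lam * ∑ j, |β j|

/-- `v` minimizes `f` among all the vectors that agree with `u` outside the coordinate `j`. -/
def IsCoordArgmin {n : ℕ} (f : (Fin n → ℝ) → ℝ) (j : Fin n) (u v : Fin n → ℝ) : Prop :=
  (∀ k, k ≠ j → v k = u k) ∧
    ∀ w : Fin n → ℝ, (∀ k, k ≠ j → w k = u k) → f v ≤ f w

/-- `x 0, x 1, x 2, …` are iterates of cyclic coordinatewise minimization of `f`: in cycle `r`,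
starting from `s r 0 = x r`, the coordinates are minimized over one after another in their
natural order, `s r i` being the vector obtained after the first `i` updates, and the result
`s r n` of the full cycle is `x (r + 1)`. -/
def IsCCMSequence {n : ℕ} (f : (Fin n → ℝ) → ℝ) (x : ℕ → (Fin n → ℝ)) : Prop :=
  ∃ s : ℕ → Fin (n + 1) → (Fin n → ℝ), ∀ r : ℕ,
    s r 0 = x r ∧
    (∀ i : Fin n, IsCoordArgmin f i (s r i.castSucc) (s r i.succ)) ∧
    x (r + 1) = s r (Fin.last n)

end

/-! ### The logistic loss -/

/-- The logistic loss `t ↦ log (1 + exp (-t))`. -/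
noncomputable def logisticLoss (t : ℝ) : ℝ := Real.log (1 + Real.exp (-t))

/-- The derivative of the logistic loss. -/
noncomputable def logisticDeriv (t : ℝ) : ℝ := -(1 + Real.exp t)⁻¹

lemma logisticLoss_nonneg (t : ℝ) : 0 ≤ logisticLoss t :=
  Real.log_nonneg (by linarith [Real.exp_pos (-t)])

lemma hasDerivAt_logisticLoss (t : ℝ) : HasDerivAt logisticLoss (logisticDeriv t) t := by
  have h := (((hasDerivAt_id t).neg.exp).const_add 1).log
    (by simp only [id]; positivity : (1 : ℝ) + Real.exp (-(id t)) ≠ 0)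
  refine h.congr_deriv ?_
  have h1 : Real.exp t ≠ 0 := (Real.exp_pos t).ne'
  simp only [logisticDeriv, id, Pi.neg_apply, Real.exp_neg]
  field_simp
  ring

lemma continuous_logisticLoss : Continuous logisticLoss :=
  continuous_iff_continuousAt.2 fun t => (hasDerivAt_logisticLoss t).continuousAt

lemma hasDerivAt_logisticDeriv (t : ℝ) :
    HasDerivAt logisticDeriv (Real.exp t / (1 + Real.exp t) ^ 2) t := by
  have h := (((Real.hasDerivAt_exp t).const_add 1).inv
    (by positivity : (1 : ℝ) + Real.exp t ≠ 0)).neg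
  refine h.congr_deriv ?_
  ring

lemma abs_logisticDeriv_sub_le (a b : ℝ) :
    |logisticDeriv a - logisticDeriv b| ≤ |a - b| := by
  have h := convex_univ.norm_image_sub_le_of_norm_hasDerivWithin_le (f := logisticDeriv)
    (C := 1) (fun t _ => (hasDerivAt_logisticDeriv t).hasDerivWithinAt)
    (fun t _ => by
      rw [Real.norm_of_nonneg (by positivity), div_le_one (by positivity)]
      nlinarith [Real.exp_pos t]) (Set.mem_univ b) (Set.mem_univ a)
  simpa using h

/-- The logistic loss is strongly convex on bounded intervals. -/
lemma exists_strongConvex_logisticLoss (M : ℝ) :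
    ∃ c > 0, ∀ a b : ℝ, |a| ≤ M → |b| ≤ M →
      logisticLoss a + logisticDeriv a * (b - a) + c * (b - a) ^ 2 ≤ logisticLoss b := by
  set k : ℝ := Real.exp (-M) / (1 + Real.exp M) ^ 2 with hk
  have hk0 : 0 < k := by positivity
  have hkle : ∀ t ∈ Set.Icc (-M) M, k ≤ Real.exp t / (1 + Real.exp t) ^ 2 := by
    intro t ht
    have h1 := Real.exp_le_exp.2 ht.1
    have h2 := Real.exp_le_exp.2 ht.2
    rw [hk]
    gcongr
  have hmono : MonotoneOn (fun t => logisticDeriv t - k * t) (Set.Icc (-M) M) := by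
    have hd : ∀ t, HasDerivAt (fun t => logisticDeriv t - k * t)
        (Real.exp t / (1 + Real.exp t) ^ 2 - k) t := fun t =>
      ((hasDerivAt_logisticDeriv t).sub ((hasDerivAt_id t).const_mul k)).congr_deriv (by simp)
    refine monotoneOn_of_hasDerivWithinAt_nonneg (convex_Icc _ _)
      (fun t _ => (hd t).continuousAt.continuousWithinAt)
      (fun t _ => (hd t).hasDerivWithinAt) (fun t ht => ?_)
    linarith [hkle t (interior_subset ht)]
  refine ⟨k / 2, by positivity, fun a b ha hb => ?_⟩
  have ha' := abs_le.1 ha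
  have hb' := abs_le.1 hb
  set φ : ℝ → ℝ := fun t => logisticLoss t - k / 2 * t ^ 2 - (logisticDeriv a - k * a) * t with hφ
  have hd : ∀ t, HasDerivAt φ ((logisticDeriv t - k * t) - (logisticDeriv a - k * a)) t := by
    intro t
    refine (((hasDerivAt_logisticLoss t).sub ((hasDerivAt_pow 2 t).const_mul (k / 2))).sub
      ((hasDerivAt_id t).const_mul (logisticDeriv a - k * a))).congr_deriv ?_
    simp
    ring
  have key : φ a ≤ φ b := by
    rcases le_total a b with hab | hab
    · refine monotoneOn_of_hasDerivWithinAt_nonneg (convex_Icc a b)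
        (fun t _ => (hd t).continuousAt.continuousWithinAt)
        (fun t _ => (hd t).hasDerivWithinAt) (fun t ht => ?_)
        (Set.left_mem_Icc.2 hab) (Set.right_mem_Icc.2 hab) hab
      have ht' := interior_subset ht
      have := hmono (a := a) (b := t) ⟨ha'.1, ha'.2⟩
        ⟨ha'.1.trans ht'.1, ht'.2.trans hb'.2⟩ ht'.1
      simp only at this
      linarith
    · refine antitoneOn_of_hasDerivWithinAt_nonpos (convex_Icc b a)
        (fun t _ => (hd t).continuousAt.continuousWithinAt)
        (fun t _ => (hd t).hasDerivWithinAt) (fun t ht => ?_)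
        (Set.left_mem_Icc.2 hab) (Set.right_mem_Icc.2 hab) hab
      have ht' := interior_subset ht
      have := hmono (a := t) (b := a) ⟨hb'.1.trans ht'.1, ht'.2.trans ha'.2⟩
        ⟨ha'.1, ha'.2⟩ ht'.2
      simp only at this
      linarith
  simp only [hφ] at key
  nlinarith [key]

/-! ### Minimizers and a Hoffman type error bound -/

lemma exists_isMinOn_of_bounded_sublevel {p : ℕ} {f : (Fin p → ℝ) → ℝ} (hf : Continuous f)
    {s : Set (Fin p → ℝ)} (hs : IsClosed s) {x₀ : Fin p → ℝ} (hx₀ : x₀ ∈ s) {R : ℝ}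
    (hR : ∀ x ∈ s, f x ≤ f x₀ → ‖x‖ ≤ R) : ∃ x ∈ s, ∀ w ∈ s, f x ≤ f w := by
  have hK : IsCompact (Metric.closedBall (0 : Fin p → ℝ) R ∩ s) :=
    (isCompact_closedBall _ _).inter_right hs
  obtain ⟨x, hx, hmin⟩ := hK.exists_isMinOn
    ⟨x₀, mem_closedBall_zero_iff.2 (hR x₀ hx₀ le_rfl), hx₀⟩ hf.continuousOn
  refine ⟨x, hx.2, fun w hw => ?_⟩
  have h0 : f x ≤ f x₀ := hmin ⟨mem_closedBall_zero_iff.2 (hR x₀ hx₀ le_rfl), hx₀⟩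
  rcases le_total (f w) (f x₀) with h | h
  · exact hmin ⟨mem_closedBall_zero_iff.2 (hR w hw h), hw⟩
  · exact h0.trans h

lemma continuous_mulVec {N p : ℕ} (A : Matrix (Fin N) (Fin p) ℝ) :
    Continuous fun β : Fin p → ℝ => A *ᵥ β :=
  Continuous.matrix_mulVec continuous_const continuous_id

/-- A matrix that is injective at `0` on a closed cone is bounded below on that cone. -/
lemma exists_norm_le_mul_norm_mulVec_of_cone {N p : ℕ} (A : Matrix (Fin N) (Fin p) ℝ)
    {K : Set (Fin p → ℝ)} (hK : IsClosed K) (hcone : ∀ d ∈ K, ∀ t : ℝ, 0 ≤ t → t • d ∈ K)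
    (hker : ∀ d ∈ K, A *ᵥ d = 0 → d = 0) :
    ∃ C : ℝ, 0 ≤ C ∧ ∀ d ∈ K, ‖d‖ ≤ C * ‖A *ᵥ d‖ := by
  have hc : IsCompact (Metric.sphere (0 : Fin p → ℝ) 1 ∩ K) :=
    (isCompact_sphere _ _).inter_right hK
  have hnormalize : ∀ d ∈ K, d ≠ 0 → ‖d‖⁻¹ • d ∈ Metric.sphere (0 : Fin p → ℝ) 1 ∩ K := by
    intro d hd h0
    refine ⟨?_, hcone d hd _ (by positivity)⟩
    rw [mem_sphere_zero_iff_norm, norm_smul, norm_inv, norm_norm,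
      inv_mul_cancel₀ (norm_ne_zero_iff.2 h0)]
  rcases (Metric.sphere (0 : Fin p → ℝ) 1 ∩ K).eq_empty_or_nonempty with he | hne
  · refine ⟨0, le_rfl, fun d hd => ?_⟩
    by_cases h0 : d = 0
    · simp [h0]
    · exact absurd (hnormalize d hd h0) (by simp [he])
  · obtain ⟨e, he, hmin⟩ := hc.exists_isMinOn hne (continuous_mulVec A).norm.continuousOn
    have hm : 0 < ‖A *ᵥ e‖ := by
      refine norm_pos_iff.2 fun h => ?_
      have := hker e he.2 h
      have h1 := mem_sphere_zero_iff_norm.1 he.1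
      simp [this] at h1
    refine ⟨‖A *ᵥ e‖⁻¹, by positivity, fun d hd => ?_⟩
    by_cases h0 : d = 0
    · simp [h0]
    have h1 : ‖A *ᵥ e‖ ≤ ‖A *ᵥ (‖d‖⁻¹ • d)‖ := hmin (hnormalize d hd h0)
    have hd0 : 0 < ‖d‖ := norm_pos_iff.2 h0
    rw [Matrix.mulVec_smul, norm_smul, norm_inv, norm_norm, ← div_eq_inv_mul,
      le_div_iff₀ hd0] at h1
    rw [← div_eq_inv_mul, le_div_iff₀ hm]
    linarith

/-- The vectors whose coordinates are zero or have the signs prescribed by `σ`. -/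
def orthantFace {p : ℕ} (σ : Fin p → SignType) : Set (Fin p → ℝ) :=
  {d | ∀ j, 0 ≤ (σ j : ℝ) * d j ∧ (σ j = 0 → d j = 0)}

lemma isClosed_orthantFace {p : ℕ} (σ : Fin p → SignType) : IsClosed (orthantFace σ) := by
  simp only [orthantFace, Set.ofPred_forall, Set.ofPred_and]
  refine isClosed_iInter fun j => (isClosed_le continuous_const (by fun_prop)).inter ?_
  by_cases h : σ j = 0
  · simpa [h] using isClosed_eq (continuous_apply j) continuous_const
  · simp [h]

lemma mem_orthantFace_sign {p : ℕ} (d : Fin p → ℝ) :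
    d ∈ orthantFace fun j => SignType.sign (d j) := by
  refine fun j => ⟨?_, fun h => sign_eq_zero_iff.1 h⟩
  rw [sign_mul_self]
  exact abs_nonneg _

lemma exists_norm_le_of_orthantFace {N p : ℕ} (A : Matrix (Fin N) (Fin p) ℝ) :
    ∃ C : ℝ, 0 ≤ C ∧ ∀ σ : Fin p → SignType, (∀ d ∈ orthantFace σ, A *ᵥ d = 0 → d = 0) →
      ∀ d ∈ orthantFace σ, ‖d‖ ≤ C * ‖A *ᵥ d‖ := by
  have h : ∀ σ : Fin p → SignType, ∃ C : ℝ, 0 ≤ C ∧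
      ((∀ d ∈ orthantFace σ, A *ᵥ d = 0 → d = 0) →
        ∀ d ∈ orthantFace σ, ‖d‖ ≤ C * ‖A *ᵥ d‖) := by
    intro σ
    by_cases hσ : ∀ d ∈ orthantFace σ, A *ᵥ d = 0 → d = 0
    · obtain ⟨C, hC, h⟩ := exists_norm_le_mul_norm_mulVec_of_cone A (isClosed_orthantFace σ)
        (fun d hd t ht j => ⟨by
          have := mul_nonneg ht (hd j).1
          simp only [Pi.smul_apply, smul_eq_mul]
          linarith, fun h0 => by simp [(hd j).2 h0]⟩) hσ
      exact ⟨C, hC, fun _ => h⟩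
    · exact ⟨0, le_rfl, fun h => absurd h hσ⟩
  choose C hC0 hC using h
  refine ⟨∑ σ, C σ, Finset.sum_nonneg fun σ _ => hC0 σ, fun σ hσ d hd => ?_⟩
  refine (hC σ hσ d hd).trans (mul_le_mul_of_nonneg_right ?_ (norm_nonneg _))
  exact Finset.single_le_sum (fun σ _ => hC0 σ) (Finset.mem_univ σ)

/-- Moving from `x` by `-t u`, where `u` has the sign of `x` and `t |u| ≤ |x|`, shrinks `|x|` by
`t |u|`. -/
lemma abs_sub_mul_of_conformal {x u t : ℝ} (h : 0 ≤ (SignType.sign x : ℝ) * u)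
    (hz : x = 0 → u = 0) (hle : t * |u| ≤ |x|) : |x - t * u| = |x| - t * |u| := by
  rcases lt_trichotomy x 0 with hx | hx | hx
  · have hu : u ≤ 0 := by simpa [sign_neg hx] using h
    rw [abs_of_nonpos hu, abs_of_neg hx] at *
    rw [abs_of_nonpos (by linarith)]
    ring
  · simp [hz hx, hx]
  · have hu : 0 ≤ u := by simpa [sign_pos hx] using h
    rw [abs_of_nonneg hu, abs_of_pos hx] at *
    rw [abs_of_nonneg (by linarith)]

lemma sub_mul_mem_uIcc_of_conformal {b g u t : ℝ} (ht : 0 ≤ t)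
    (h : 0 ≤ (SignType.sign (g - b) : ℝ) * u) (hz : g - b = 0 → u = 0)
    (hle : t * |u| ≤ |g - b|) : g - t * u ∈ Set.uIcc b g := by
  rcases lt_trichotomy (g - b) 0 with hx | hx | hx
  · have hu : u ≤ 0 := by simpa [sign_neg hx] using h
    rw [abs_of_nonpos hu, abs_of_neg hx] at hle
    have := mul_nonneg ht (neg_nonneg.2 hu)
    rw [Set.mem_uIcc]
    right
    constructor <;> linarith
  · simp [hz hx]
  · have hu : 0 ≤ u := by simpa [sign_pos hx] using h
    rw [abs_of_nonneg hu, abs_of_pos hx] at hle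
    have := mul_nonneg ht hu
    rw [Set.mem_uIcc]
    left
    constructor <;> linarith

/-- **Hoffman's error bound** for systems `A γ = A γ₀`, `γ ∈ ∏ j, P j`, at the points of the box
`∏ j, P j`. The constant does not depend on the box. -/
theorem exists_hoffman_bound {N p : ℕ} (A : Matrix (Fin N) (Fin p) ℝ) :
    ∃ C : ℝ, 0 ≤ C ∧ ∀ P : Fin p → Set ℝ, (∀ j, IsClosed (P j)) → (∀ j, (P j).OrdConnected) →
      ∀ β γ₀ : Fin p → ℝ, (∀ j, β j ∈ P j) → (∀ j, γ₀ j ∈ P j) →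
        ∃ γ : Fin p → ℝ, (∀ j, γ j ∈ P j) ∧ A *ᵥ γ = A *ᵥ γ₀ ∧
          ‖γ - β‖ ≤ C * ‖A *ᵥ γ₀ - A *ᵥ β‖ := by
  obtain ⟨C, hC0, hC⟩ := exists_norm_le_of_orthantFace A
  refine ⟨C, hC0, fun P hcl hoc β γ₀ hβ hγ₀ => ?_⟩
  have hs : IsClosed {γ : Fin p → ℝ | (∀ j, γ j ∈ P j) ∧ A *ᵥ γ = A *ᵥ γ₀} := by
    have := (isClosed_set_pi (i := Set.univ) fun j _ => hcl j).inter
      (isClosed_eq (continuous_mulVec A) (continuous_const (y := A *ᵥ γ₀)))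
    convert this using 1
    ext γ
    simp
  obtain ⟨γ, ⟨hγP, hγA⟩, hmin⟩ := exists_isMinOn_of_bounded_sublevel
    (f := fun γ => ∑ j, |γ j - β j|) (by fun_prop) hs (x₀ := γ₀) ⟨hγ₀, rfl⟩
    (R := ∑ j, |γ₀ j - β j| + ‖β‖) (by
      intro x _ hx
      have h1 : ‖x - β‖ ≤ ∑ j, |x j - β j| := by
        refine (pi_norm_le_iff_of_nonneg (Finset.sum_nonneg fun _ _ => abs_nonneg _)).2 fun j => ?_
        exact Finset.single_le_sum (f := fun j => |x j - β j|) (fun _ _ => abs_nonneg _)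
          (Finset.mem_univ j)
      have h2 := norm_le_norm_sub_add x β
      linarith)
  refine ⟨γ, hγP, hγA, ?_⟩
  rw [← hγA, ← Matrix.mulVec_sub]
  refine hC _ (fun u hu hAu => ?_) (γ - β) (mem_orthantFace_sign _)
  by_contra hu0
  have hz : ∀ j, γ j - β j = 0 → u j = 0 := fun j h => (hu j).2 (sign_eq_zero_iff.2 h)
  have hsgn : ∀ j, 0 ≤ (SignType.sign (γ j - β j) : ℝ) * u j := fun j => (hu j).1
  obtain ⟨t, hle, ht⟩ : ∃ t : ℝ, (∀ j, t * |u j| ≤ |γ j - β j|) ∧ 0 < t := by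
    have hev : ∀ᶠ t : ℝ in 𝓝[>] 0, ∀ j, t * |u j| ≤ |γ j - β j| := by
      refine eventually_all.2 fun j => ?_
      by_cases h : γ j - β j = 0
      · simp [hz j h]
      · have hlim : Tendsto (fun t : ℝ => t * |u j|) (𝓝[>] 0) (𝓝 (0 * |u j|)) :=
          ((continuous_id.mul continuous_const).tendsto 0).mono_left nhdsWithin_le_nhds
        rw [zero_mul] at hlim
        exact (hlim.eventually (gt_mem_nhds (abs_pos.2 h))).mono fun _ h => h.le
    exact (hev.and self_mem_nhdsWithin).exists
  have h1 := hmin (γ - t • u) ⟨fun j => (hoc j).uIcc_subset (hβ j) (hγP j)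
    (sub_mul_mem_uIcc_of_conformal ht.le (hsgn j) (hz j) (hle j)), by
      rw [Matrix.mulVec_sub, Matrix.mulVec_smul, hAu, smul_zero, sub_zero, hγA]⟩
  obtain ⟨k, hk⟩ := Function.ne_iff.1 hu0
  refine absurd h1 (not_le.2 (Finset.sum_lt_sum (fun j _ => ?_) ⟨k, Finset.mem_univ k, ?_⟩))
  all_goals
    simp only [Pi.sub_apply, Pi.smul_apply, smul_eq_mul]
    rw [sub_right_comm, abs_sub_mul_of_conformal (hsgn _) (hz _) (hle _)]
  · linarith [mul_nonneg ht.le (abs_nonneg (u j))]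
  · linarith [mul_pos ht (abs_pos.2 hk)]

/-! ### The penalized logistic objective -/

/-- The unpenalized logistic objective with margins `A β`. -/
noncomputable def logisticSum {N p : ℕ} (A : Matrix (Fin N) (Fin p) ℝ) (β : Fin p → ℝ) : ℝ :=
  ∑ i, logisticLoss ((A *ᵥ β) i)

/-- The gradient of `logisticSum A`. -/
noncomputable def logisticGrad {N p : ℕ} (A : Matrix (Fin N) (Fin p) ℝ) (β : Fin p → ℝ)
    (j : Fin p) : ℝ :=
  ∑ i, logisticDeriv ((A *ᵥ β) i) * A i j

/-- The `ℓ₁`-penalized logistic objective with margins `A β`. -/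
noncomputable def lassoLogistic {N p : ℕ} (A : Matrix (Fin N) (Fin p) ℝ) (lam : ℝ)
    (β : Fin p → ℝ) : ℝ :=
  logisticSum A β + lam * ∑ j, |β j|

section

variable {N p : ℕ} (A : Matrix (Fin N) (Fin p) ℝ) {lam : ℝ}

lemma sum_logisticGrad_mul (β d : Fin p → ℝ) :
    ∑ j, logisticGrad A β j * d j = ∑ i, logisticDeriv ((A *ᵥ β) i) * (A *ᵥ d) i := by
  simp only [logisticGrad, Matrix.mulVec, dotProduct, Finset.sum_mul, Finset.mul_sum]
  rw [Finset.sum_comm]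
  exact Finset.sum_congr rfl fun i _ => Finset.sum_congr rfl fun j _ => by ring

lemma continuous_lassoLogistic : Continuous (lassoLogistic A lam) := by
  have h := continuous_mulVec A
  have h' : ∀ i, Continuous fun β : Fin p → ℝ => (A *ᵥ β) i := fun i =>
    (continuous_apply i).comp h
  unfold lassoLogistic logisticSum
  exact (continuous_finsetSum _ fun i _ => continuous_logisticLoss.comp (h' i)).add
    (by fun_prop)

variable {A}

lemma logisticSum_nonneg (β : Fin p → ℝ) : 0 ≤ logisticSum A β :=
  Finset.sum_nonneg fun _ _ => logisticLoss_nonneg _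

lemma norm_le_of_lassoLogistic_le (hlam : 0 < lam) {β : Fin p → ℝ} {T : ℝ}
    (h : lassoLogistic A lam β ≤ T) : ‖β‖ ≤ T / lam := by
  have h1 : lam * ∑ j, |β j| ≤ T := by
    have := logisticSum_nonneg (A := A) β
    unfold lassoLogistic at h
    linarith
  have h2 : ∑ j, |β j| ≤ T / lam := by
    rw [le_div_iff₀ hlam]
    linarith
  have h0 : 0 ≤ ∑ j, |β j| := Finset.sum_nonneg fun _ _ => abs_nonneg _
  refine (pi_norm_le_iff_of_nonneg (h0.trans h2)).2 fun j => le_trans ?_ h2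
  exact Finset.single_le_sum (f := fun j => |β j|) (fun _ _ => abs_nonneg _) (Finset.mem_univ j)

lemma exists_norm_mulVec_le (A : Matrix (Fin N) (Fin p) ℝ) :
    ∃ L : ℝ, 0 ≤ L ∧ ∀ d : Fin p → ℝ, ‖A *ᵥ d‖ ≤ L * ‖d‖ :=
  ⟨‖LinearMap.toContinuousLinearMap (Matrix.mulVecLin A)‖, norm_nonneg _, fun d =>
    (LinearMap.toContinuousLinearMap (Matrix.mulVecLin A)).le_opNorm d⟩

/-- On sublevel sets the smooth part of the objective is strongly convex in the margins. -/
lemma exists_strongConvex_lassoLogistic (A : Matrix (Fin N) (Fin p) ℝ) (hlam : 0 < lam) (T : ℝ) :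
    ∃ c > 0, ∀ β γ : Fin p → ℝ, lassoLogistic A lam β ≤ T → lassoLogistic A lam γ ≤ T →
      lassoLogistic A lam β + ∑ j, (logisticGrad A β j * (γ j - β j) + lam * (|γ j| - |β j|))
        + c * ∑ i, (A *ᵥ (γ - β)) i ^ 2 ≤ lassoLogistic A lam γ := by
  obtain ⟨L, hL, hAL⟩ := exists_norm_mulVec_le A
  obtain ⟨c, hc, h⟩ := exists_strongConvex_logisticLoss (L * (T / lam))
  have hM : ∀ β, lassoLogistic A lam β ≤ T → ∀ i, |(A *ᵥ β) i| ≤ L * (T / lam) := fun β hβ i =>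
    (norm_le_pi_norm (A *ᵥ β) i).trans ((hAL β).trans
      (mul_le_mul_of_nonneg_left (norm_le_of_lassoLogistic_le hlam hβ) hL))
  refine ⟨c, hc, fun β γ hβ hγ => ?_⟩
  have h1 := Finset.sum_le_sum fun i (_ : i ∈ Finset.univ) =>
    h ((A *ᵥ β) i) ((A *ᵥ γ) i) (hM β hβ i) (hM γ hγ i)
  have h2 := sum_logisticGrad_mul A β (γ - β)
  simp only [Matrix.mulVec_sub, Pi.sub_apply] at h2 ⊢
  simp only [Finset.sum_add_distrib, ← Finset.mul_sum, Finset.sum_sub_distrib, h2] at h1 ⊢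
  unfold lassoLogistic logisticSum
  linarith

/-- The first-order optimality condition in a single coordinate. -/
lemma IsCoordArgmin.variational {j : Fin p} {u v : Fin p → ℝ}
    (h : IsCoordArgmin (lassoLogistic A lam) j u v) (hlam : 0 < lam) (w : ℝ) :
    0 ≤ logisticGrad A v j * (w - v j) + lam * (|w| - |v j|) := by
  set e : Fin p → ℝ := Pi.single j (w - v j) with he
  set φ : ℝ → ℝ := fun t => logisticSum A (v + t • e) + t * (lam * (|w| - |v j|)) with hφ
  have hd : HasDerivAt φ (logisticGrad A v j * (w - v j) + lam * (|w| - |v j|)) 0 := by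
    have h1 : logisticGrad A v j * (w - v j) =
        ∑ i, logisticDeriv ((A *ᵥ v) i) * (A *ᵥ e) i := by
      rw [← sum_logisticGrad_mul, Finset.sum_eq_single j] <;> simp +contextual [he]
    rw [h1]
    refine HasDerivAt.add ?_ (by simpa using (hasDerivAt_id (0 : ℝ)).mul_const _)
    unfold logisticSum
    refine HasDerivAt.fun_sum fun i _ => ?_
    simp only [Matrix.mulVec_add, Matrix.mulVec_smul, Pi.add_apply, Pi.smul_apply, smul_eq_mul]
    have h2 : HasDerivAt (fun t : ℝ => (A *ᵥ v) i + t * (A *ᵥ e) i) ((A *ᵥ e) i) 0 := by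
      simpa using ((hasDerivAt_id (0 : ℝ)).mul_const ((A *ᵥ e) i)).const_add ((A *ᵥ v) i)
    refine HasDerivAt.comp (h₂ := logisticLoss) (0 : ℝ) ?_ h2
    simpa using hasDerivAt_logisticLoss ((A *ᵥ v) i)
  have hpos : ∀ t : ℝ, 0 ≤ t → t ≤ 1 → φ 0 ≤ φ t := by
    intro t ht0 ht1
    have h1 := h.2 (v + t • e) fun k hk => by simp [he, hk, h.1 k hk]
    have h2 : ∑ k, |(v + t • e) k| - ∑ k, |v k| ≤ t * (|w| - |v j|) := by
      rw [← Finset.sum_sub_distrib, Finset.sum_eq_single j]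
      · have h3 : (v + t • e) j = (1 - t) * v j + t * w := by
          simp [he]
          ring
        have h4 := abs_add_le ((1 - t) * v j) (t * w)
        rw [abs_mul, abs_mul, abs_of_nonneg ht0, abs_of_nonneg (sub_nonneg.2 ht1)] at h4
        rw [h3]
        linarith
      · intro k _ hk
        simp [he, hk]
      · simp
    have h3 := mul_le_mul_of_nonneg_left h2 hlam.le
    simp only [hφ, zero_smul, add_zero, zero_mul]
    unfold lassoLogistic at h1
    linarith
  refine ge_of_tendsto hd.tendsto_slope_zero_right ?_
  filter_upwards [Ioc_mem_nhdsGT (zero_lt_one (α := ℝ))] with t ht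
  have := hpos t ht.1.le ht.2
  rw [zero_add, smul_eq_mul]
  exact mul_nonneg (inv_nonneg.2 ht.1.le) (sub_nonneg.2 this)

lemma exists_logisticGrad_lipschitz (A : Matrix (Fin N) (Fin p) ℝ) :
    ∃ L : ℝ, 0 ≤ L ∧ ∀ (β γ : Fin p → ℝ) (j : Fin p),
      |logisticGrad A β j - logisticGrad A γ j| ≤ L * ‖β - γ‖ := by
  obtain ⟨L, hL, hAL⟩ := exists_norm_mulVec_le A
  refine ⟨L * ∑ i, ∑ j, |A i j|, mul_nonneg hL
    (Finset.sum_nonneg fun _ _ => Finset.sum_nonneg fun _ _ => abs_nonneg _), fun β γ j => ?_⟩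
  unfold logisticGrad
  rw [← Finset.sum_sub_distrib, mul_assoc, mul_comm _ ‖β - γ‖, ← mul_assoc, Finset.mul_sum]
  refine (Finset.abs_sum_le_sum_abs _ _).trans (Finset.sum_le_sum fun i _ => ?_)
  rw [← sub_mul, abs_mul]
  refine mul_le_mul ?_ ?_ (abs_nonneg _) (mul_nonneg hL (norm_nonneg _))
  · refine (abs_logisticDeriv_sub_le _ _).trans ?_
    have h := norm_le_pi_norm (A *ᵥ (β - γ)) i
    rw [Matrix.mulVec_sub, Pi.sub_apply, Real.norm_eq_abs, ← Matrix.mulVec_sub] at h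
    exact h.trans (hAL _)
  · exact Finset.single_le_sum (f := fun j => |A i j|) (fun _ _ => abs_nonneg _)
      (Finset.mem_univ j)

/-- Sufficient decrease: the objective has quadratic growth around coordinatewise minimizers,
along that coordinate. -/
lemma exists_sufficient_decrease (hA : ∀ j, A.col j ≠ 0) (hlam : 0 < lam) (T : ℝ) :
    ∃ c > 0, ∀ (j : Fin p) (u v w : Fin p → ℝ), lassoLogistic A lam u ≤ T →
      IsCoordArgmin (lassoLogistic A lam) j u v → (∀ k, k ≠ j → w k = u k) →
      lassoLogistic A lam w ≤ T →
      lassoLogistic A lam v + c * (w j - v j) ^ 2 ≤ lassoLogistic A lam w := by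
  obtain ⟨c, hc, h⟩ := exists_strongConvex_lassoLogistic A hlam T
  have hcol : ∀ j, 0 < ∑ i, A i j ^ 2 := by
    intro j
    obtain ⟨i, hi⟩ := Function.ne_iff.1 (hA j)
    exact Finset.sum_pos' (fun _ _ => sq_nonneg _) ⟨i, Finset.mem_univ i, sq_pos_of_ne_zero hi⟩
  obtain ⟨m, hm, hmle⟩ : ∃ m > 0, ∀ j, m ≤ ∑ i, A i j ^ 2 := by
    rcases isEmpty_or_nonempty (Fin p) with hp | hp
    · exact ⟨1, one_pos, fun j => hp.elim j⟩
    · obtain ⟨j, hj⟩ := Finite.exists_min fun j => ∑ i, A i j ^ 2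
      exact ⟨_, hcol j, hj⟩
  refine ⟨c * m, mul_pos hc hm, fun j u v w hu hv hwu hw => ?_⟩
  have hvT : lassoLogistic A lam v ≤ T := (hv.2 u fun _ _ => rfl).trans hu
  have h1 := h v w hvT hw
  have hwv : ∀ k, k ≠ j → w k = v k := fun k hk => (hwu k hk).trans (hv.1 k hk).symm
  rw [Finset.sum_eq_single j (fun k _ hk => by simp [hwv k hk]) (by simp)] at h1
  have h2 := hv.variational hlam (w j)
  have h3 : ∑ i, (A *ᵥ (w - v)) i ^ 2 = (w j - v j) ^ 2 * ∑ i, A i j ^ 2 := by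
    rw [Finset.mul_sum]
    refine Finset.sum_congr rfl fun i _ => ?_
    rw [Matrix.mulVec, dotProduct, Finset.sum_eq_single j
      (fun k _ hk => by simp [hwv k hk]) (by simp), Pi.sub_apply]
    ring
  have h4 : c * m * (w j - v j) ^ 2 ≤ c * ∑ i, (A *ᵥ (w - v)) i ^ 2 := by
    rw [h3, mul_assoc, mul_comm m]
    exact mul_le_mul_of_nonneg_left (mul_le_mul_of_nonneg_left (hmle j) (sq_nonneg _)) hc.le
  linarith

theorem existsUnique_isCoordArgmin (hA : ∀ j, A.col j ≠ 0) (hlam : 0 < lam) (β : Fin p → ℝ)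
    (j : Fin p) : ∃! v : Fin p → ℝ, IsCoordArgmin (lassoLogistic A lam) j β v := by
  have hs : IsClosed {v : Fin p → ℝ | ∀ k, k ≠ j → v k = β k} := by
    simp only [Set.ofPred_forall]
    exact isClosed_iInter fun k => isClosed_iInter fun _ =>
      isClosed_eq (continuous_apply k) continuous_const
  obtain ⟨v, hv, hmin⟩ := exists_isMinOn_of_bounded_sublevel
    (continuous_lassoLogistic A (lam := lam)) hs (x₀ := β) (fun _ _ => rfl)
    (fun x _ hx => norm_le_of_lassoLogistic_le hlam hx)
  have hva : IsCoordArgmin (lassoLogistic A lam) j β v := ⟨hv, hmin⟩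
  refine ⟨v, hva, fun w hw => ?_⟩
  obtain ⟨c, hc, h⟩ := exists_sufficient_decrease hA hlam (lassoLogistic A lam β)
  have h1 := h j β v w le_rfl hva hw.1 (hw.2 β fun _ _ => rfl)
  have h2 := hw.2 v hv
  have h3 : (w j - v j) ^ 2 = 0 := by
    refine le_antisymm ?_ (sq_nonneg _)
    by_contra hlt
    linarith [mul_pos hc (not_le.1 hlt)]
  funext k
  by_cases hk : k = j
  · subst hk
    exact sub_eq_zero.1 (pow_eq_zero_iff two_ne_zero |>.1 h3)
  · exact (hw.1 k hk).trans (hv k hk).symm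

end

/-! ### The error bound for the penalized logistic objective -/

lemma isClosed_setOf_penalty_nonpos (lam g : ℝ) : IsClosed {t : ℝ | lam * |t| + g * t ≤ 0} :=
  isClosed_le (by fun_prop) continuous_const

lemma ordConnected_setOf_penalty_nonpos {lam g : ℝ} (h : ∀ t : ℝ, 0 ≤ lam * |t| + g * t) :
    {t : ℝ | lam * |t| + g * t ≤ 0}.OrdConnected := by
  refine ⟨fun a ha b hb x hx => ?_⟩
  simp only [Set.mem_ofPred_eq] at ha hb ⊢
  have h1 := h 1
  have h2 := h (-1)
  rw [abs_one] at h1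
  rw [abs_neg, abs_one] at h2
  rcases le_total 0 x with h0 | h0
  · rw [abs_of_nonneg (h0.trans hx.2)] at hb
    rw [abs_of_nonneg h0]
    nlinarith [hx.2]
  · rw [abs_of_nonpos (hx.1.trans h0)] at ha
    rw [abs_of_nonpos h0]
    nlinarith [hx.1]

lemma exists_penalty_error_bound {lam g : ℝ} (h : ∀ t : ℝ, 0 ≤ lam * |t| + g * t) :
    ∃ C : ℝ, 0 ≤ C ∧ ∀ t : ℝ, ∃ t', lam * |t'| + g * t' ≤ 0 ∧
      |t' - t| ≤ C * (lam * |t| + g * t) := by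
  have h1 := h 1
  have h2 := h (-1)
  rw [abs_one] at h1
  rw [abs_neg, abs_one] at h2
  have h1' : 0 ≤ lam + g := by linarith
  have h2' : 0 ≤ lam - g := by linarith
  have i1 := inv_nonneg.2 h1'
  have i2 := inv_nonneg.2 h2'
  refine ⟨(lam + g)⁻¹ + (lam - g)⁻¹, by positivity, fun t => ?_⟩
  rcases le_or_gt (lam * |t| + g * t) 0 with ht | ht
  · exact ⟨t, ht, by
      rw [sub_self, abs_zero]
      exact mul_nonneg (by positivity) (h t)⟩
  refine ⟨0, by simp, ?_⟩
  rw [zero_sub, abs_neg]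
  rcases le_total 0 t with h0 | h0
  · rw [abs_of_nonneg h0, ← add_mul] at *
    have hne : lam + g ≠ 0 := fun h => by simp [h] at ht
    have := inv_mul_cancel_left₀ hne t
    nlinarith [mul_nonneg i2 ht.le]
  · rw [abs_of_nonpos h0] at *
    have hψ : lam * -t + g * t = (lam - g) * -t := by ring
    rw [hψ] at ht ⊢
    have hne : lam - g ≠ 0 := fun h => by simp [h] at ht
    have := inv_mul_cancel_left₀ hne (-t)
    nlinarith [mul_nonneg i1 ht.le]

section

variable {N p : ℕ} {A : Matrix (Fin N) (Fin p) ℝ} {lam : ℝ} {βs : Fin p → ℝ}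

lemma penalty_of_isMin (hlam : 0 < lam)
    (hmin : ∀ β, lassoLogistic A lam βs ≤ lassoLogistic A lam β) (j : Fin p) :
    lam * |βs j| + logisticGrad A βs j * βs j = 0 ∧
      ∀ t : ℝ, 0 ≤ lam * |t| + logisticGrad A βs j * t := by
  have h : ∀ w : ℝ, _ := (show IsCoordArgmin (lassoLogistic A lam) j βs βs from
    ⟨fun _ _ => rfl, fun w _ => hmin w⟩).variational hlam
  have h0 := h 0
  have h2 := h (2 * βs j)
  rw [abs_zero] at h0
  rw [abs_mul, abs_two] at h2
  have heq : lam * |βs j| + logisticGrad A βs j * βs j = 0 := by linarith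
  exact ⟨heq, fun t => by linarith [h t]⟩

/-- The distance to the set of minimizers is bounded by the square root of the gap in the
objective, uniformly on sublevel sets. -/
theorem exists_sqrt_error_bound (hlam : 0 < lam)
    (hmin : ∀ β, lassoLogistic A lam βs ≤ lassoLogistic A lam β) (T : ℝ) :
    ∃ C : ℝ, 0 ≤ C ∧ ∀ β, lassoLogistic A lam β ≤ T →
      ∃ γ, lassoLogistic A lam γ = lassoLogistic A lam βs ∧
        ‖γ - β‖ ≤ C * √(lassoLogistic A lam β - lassoLogistic A lam βs) := by
  have hpen := penalty_of_isMin hlam hmin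
  obtain ⟨c, hc, hstrong⟩ := exists_strongConvex_lassoLogistic A hlam T
  obtain ⟨C₁, hC₁, hhoff⟩ := exists_hoffman_bound A
  obtain ⟨L, hL, hAL⟩ := exists_norm_mulVec_le A
  choose C₂ hC₂ hproj using fun j => exists_penalty_error_bound (hpen j).2
  set W : ℝ := √(T - lassoLogistic A lam βs) with hW
  have hW0 : 0 ≤ W := Real.sqrt_nonneg _
  set D : ℝ := (∑ j, C₂ j) * W with hD
  have hD0 : 0 ≤ D := mul_nonneg (Finset.sum_nonneg fun j _ => hC₂ j) hW0
  refine ⟨C₁ * ((√c)⁻¹ + L * D) + D, by positivity, fun β hβ => ?_⟩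
  set Δ : ℝ := lassoLogistic A lam β - lassoLogistic A lam βs with hΔ
  have hΔ0 : 0 ≤ Δ := sub_nonneg.2 (hmin β)
  have hsW : √Δ ≤ W := Real.sqrt_le_sqrt (by linarith)
  have hgrowth : ∑ j, (lam * |β j| + logisticGrad A βs j * β j)
      + c * ∑ i, (A *ᵥ (β - βs)) i ^ 2 ≤ Δ := by
    have h := hstrong βs β ((hmin β).trans hβ) hβ
    have h1 : ∑ j, (logisticGrad A βs j * (β j - βs j) + lam * (|β j| - |βs j|)) =
        ∑ j, (lam * |β j| + logisticGrad A βs j * β j) :=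
      Finset.sum_congr rfl fun j _ => by linarith [(hpen j).1]
    rw [h1] at h
    linarith
  have hψ0 : 0 ≤ ∑ j, (lam * |β j| + logisticGrad A βs j * β j) :=
    Finset.sum_nonneg fun j _ => (hpen j).2 _
  have hsq0 : 0 ≤ ∑ i, (A *ᵥ (β - βs)) i ^ 2 := Finset.sum_nonneg fun i _ => sq_nonneg _
  have hmargin : ‖A *ᵥ (β - βs)‖ ≤ (√c)⁻¹ * √Δ := by
    refine (pi_norm_le_iff_of_nonneg (by positivity)).2 fun i => ?_
    have h1 := Finset.single_le_sum (f := fun i => (A *ᵥ (β - βs)) i ^ 2)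
      (fun _ _ => sq_nonneg _) (Finset.mem_univ i)
    have h2 : (A *ᵥ (β - βs)) i ^ 2 ≤ Δ / c := by
      rw [le_div_iff₀ hc]
      nlinarith
    have h3 := Real.abs_le_sqrt h2
    rwa [Real.sqrt_div hΔ0, div_eq_inv_mul] at h3
  choose β' hβ'P hβ' using fun j => hproj j (β j)
  have hdist : ‖β' - β‖ ≤ D * √Δ := by
    refine (pi_norm_le_iff_of_nonneg (by positivity)).2 fun j => (hβ' j).trans ?_
    have h1 : lam * |β j| + logisticGrad A βs j * β j ≤ W * √Δ := by
      have h2 := Finset.single_le_sum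
        (f := fun j => lam * |β j| + logisticGrad A βs j * β j)
        (fun j _ => (hpen j).2 _) (Finset.mem_univ j)
      have h3 := mul_le_mul_of_nonneg_right hsW (Real.sqrt_nonneg Δ)
      rw [Real.mul_self_sqrt hΔ0] at h3
      have h4 := mul_nonneg hc.le hsq0
      linarith
    rw [hD, mul_assoc]
    exact mul_le_mul (Finset.single_le_sum (fun j _ => hC₂ j) (Finset.mem_univ j)) h1
      ((hpen j).2 _) (Finset.sum_nonneg fun j _ => hC₂ j)
  obtain ⟨γ, hγP, hγA, hγ⟩ := hhoff
    (fun j => {t : ℝ | lam * |t| + logisticGrad A βs j * t ≤ 0})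
    (fun j => isClosed_setOf_penalty_nonpos _ _)
    (fun j => ordConnected_setOf_penalty_nonpos (hpen j).2) β' βs hβ'P (fun j => (hpen j).1.le)
  refine ⟨γ, ?_, ?_⟩
  · have h1 : ∀ δ : Fin p → ℝ, (∀ j, lam * |δ j| + logisticGrad A βs j * δ j = 0) →
        lam * ∑ j, |δ j| = -∑ i, logisticDeriv ((A *ᵥ βs) i) * (A *ᵥ δ) i := by
      intro δ hδ
      rw [← sum_logisticGrad_mul, Finset.mul_sum, ← Finset.sum_neg_distrib]
      exact Finset.sum_congr rfl fun j _ => by linarith [hδ j]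
    unfold lassoLogistic logisticSum
    rw [h1 γ fun j => le_antisymm (hγP j) ((hpen j).2 _), h1 βs fun j => (hpen j).1, hγA]
  · have h1 : ‖A *ᵥ βs - A *ᵥ β'‖ ≤ (√c)⁻¹ * √Δ + L * (D * √Δ) := by
      have h2 : A *ᵥ βs - A *ᵥ β' = -(A *ᵥ (β - βs) + A *ᵥ (β' - β)) := by
        simp only [Matrix.mulVec_sub]
        abel
      rw [h2, norm_neg]
      exact (norm_add_le _ _).trans (add_le_add hmargin
        ((hAL _).trans (mul_le_mul_of_nonneg_left hdist hL)))
    have h2 := norm_add_le (γ - β') (β' - β)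
    rw [sub_add_sub_cancel] at h2
    have h3 := hγ.trans (mul_le_mul_of_nonneg_left h1 hC₁)
    linarith

/-! ### Convergence of cyclic coordinatewise minimization -/

lemma eq_first_of_cycle {f : (Fin p → ℝ) → ℝ} {s : Fin (p + 1) → Fin p → ℝ}
    (hs : ∀ i : Fin p, IsCoordArgmin f i (s i.castSucc) (s i.succ)) (k : Fin p)
    (m : Fin (p + 1)) : m ≤ k.castSucc → s m k = s 0 k := by
  induction m using Fin.induction with
  | zero => exact fun _ => rfl
  | succ i ih =>
    intro h
    have hik : i < k := Fin.succ_le_castSucc_iff.1 h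
    rw [(hs i).1 k hik.ne']
    exact ih (Fin.castSucc_le_castSucc_iff.2 hik.le)

lemma eq_last_of_cycle {f : (Fin p → ℝ) → ℝ} {s : Fin (p + 1) → Fin p → ℝ}
    (hs : ∀ i : Fin p, IsCoordArgmin f i (s i.castSucc) (s i.succ)) (k : Fin p)
    (m : Fin (p + 1)) : k.succ ≤ m → s m k = s (Fin.last p) k := by
  induction m using Fin.reverseInduction with
  | last => exact fun _ => rfl
  | cast i ih =>
    intro h
    have hki : k < i := Fin.succ_le_castSucc_iff.1 h
    rw [← (hs i).1 k hki.ne]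
    exact ih (Fin.succ_le_succ_iff.2 hki.le)

/-- In one cycle, every intermediate vector is as close to the last one as the first one is. -/
lemma norm_sub_last_le_of_cycle {f : (Fin p → ℝ) → ℝ} {s : Fin (p + 1) → Fin p → ℝ}
    (hs : ∀ i : Fin p, IsCoordArgmin f i (s i.castSucc) (s i.succ)) (i : Fin p) :
    ‖s i.succ - s (Fin.last p)‖ ≤ ‖s (Fin.last p) - s 0‖ := by
  refine (pi_norm_le_iff_of_nonneg (norm_nonneg _)).2 fun k => ?_
  rw [Pi.sub_apply]
  rcases le_or_gt k i with hk | hk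
  · rw [eq_last_of_cycle hs k _ (Fin.succ_le_succ_iff.2 hk), sub_self, norm_zero]
    exact norm_nonneg _
  · rw [eq_first_of_cycle hs k _ (Fin.succ_le_castSucc_iff.2 hk), norm_sub_rev]
    exact norm_le_pi_norm (s (Fin.last p) - s 0) k

lemma antitone_of_cycle {f : (Fin p → ℝ) → ℝ} {s : Fin (p + 1) → Fin p → ℝ}
    (hs : ∀ i : Fin p, IsCoordArgmin f i (s i.castSucc) (s i.succ)) : Antitone (f ∘ s) :=
  Fin.antitone_iff_succ_le.2 fun i => (hs i).2 _ fun _ _ => rfl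

lemma exists_cycle_decrease (hA : ∀ j, A.col j ≠ 0) (hlam : 0 < lam) (T : ℝ) :
    ∃ c > 0, ∀ s : Fin (p + 1) → Fin p → ℝ,
      (∀ i : Fin p, IsCoordArgmin (lassoLogistic A lam) i (s i.castSucc) (s i.succ)) →
      lassoLogistic A lam (s 0) ≤ T →
      c * ‖s (Fin.last p) - s 0‖ ^ 2 ≤
        lassoLogistic A lam (s 0) - lassoLogistic A lam (s (Fin.last p)) := by
  obtain ⟨c, hc, h⟩ := exists_sufficient_decrease hA hlam T
  refine ⟨c, hc, fun s hs hT => ?_⟩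
  have hanti := antitone_of_cycle hs
  have hgap : 0 ≤ lassoLogistic A lam (s 0) - lassoLogistic A lam (s (Fin.last p)) :=
    sub_nonneg.2 (hanti (Fin.zero_le _))
  have hnorm : ‖s (Fin.last p) - s 0‖ ≤
      √((lassoLogistic A lam (s 0) - lassoLogistic A lam (s (Fin.last p))) / c) := by
    refine (pi_norm_le_iff_of_nonneg (Real.sqrt_nonneg _)).2 fun i => Real.abs_le_sqrt ?_
    rw [le_div_iff₀ hc]
    have h0 : lassoLogistic A lam (s i.castSucc) ≤ lassoLogistic A lam (s 0) :=
      hanti (Fin.zero_le _)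
    have h1 : lassoLogistic A lam (s (Fin.last p)) ≤ lassoLogistic A lam (s i.succ) :=
      hanti (Fin.le_last _)
    have h2 := h i _ _ _ (h0.trans hT) (hs i) (fun _ _ => rfl) (h0.trans hT)
    rw [eq_first_of_cycle hs i _ le_rfl, eq_last_of_cycle hs i _ le_rfl] at h2
    rw [Pi.sub_apply]
    linarith
  have h1 := pow_le_pow_left₀ (norm_nonneg _) hnorm 2
  rw [Real.sq_sqrt (div_nonneg hgap hc.le), le_div_iff₀ hc] at h1
  linarith

lemma exists_cycle_gap_bound (hlam : 0 < lam)
    (hmin : ∀ β, lassoLogistic A lam βs ≤ lassoLogistic A lam β) (T : ℝ) :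
    ∃ K : ℝ, 0 ≤ K ∧ ∀ s : Fin (p + 1) → Fin p → ℝ,
      (∀ i : Fin p, IsCoordArgmin (lassoLogistic A lam) i (s i.castSucc) (s i.succ)) →
      lassoLogistic A lam (s 0) ≤ T →
      lassoLogistic A lam (s (Fin.last p)) - lassoLogistic A lam βs ≤
        K * ‖s (Fin.last p) - s 0‖ ^ 2 := by
  obtain ⟨c, hc, hstrong⟩ := exists_strongConvex_lassoLogistic A hlam T
  obtain ⟨C, hC, herr⟩ := exists_sqrt_error_bound hlam hmin T
  obtain ⟨L, hL, hgrad⟩ := exists_logisticGrad_lipschitz A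
  refine ⟨(p * (L * C)) ^ 2, sq_nonneg _, fun s hs hT => ?_⟩
  have hvT : lassoLogistic A lam (s (Fin.last p)) ≤ T :=
    (antitone_of_cycle hs (Fin.zero_le _)).trans hT
  obtain ⟨γ, hγQ, hγ⟩ := herr _ hvT
  set v := s (Fin.last p) with hv
  set d : ℝ := ‖v - s 0‖ with hd
  have hd0 : 0 ≤ d := norm_nonneg _
  set Δ : ℝ := lassoLogistic A lam v - lassoLogistic A lam βs with hΔ
  have hΔ0 : 0 ≤ Δ := sub_nonneg.2 (hmin v)
  have h1 := hstrong v γ hvT (hγQ.trans_le ((hmin v).trans hvT))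
  have h2 : -∑ j, (logisticGrad A v j * (γ j - v j) + lam * (|γ j| - |v j|)) ≤
      ∑ _j : Fin p, L * d * (C * √Δ) := by
    rw [← Finset.sum_neg_distrib]
    refine Finset.sum_le_sum fun j _ => ?_
    have h3 := (hs j).variational hlam (γ j)
    rw [eq_last_of_cycle hs j _ le_rfl, ← hv] at h3
    have h4 : (logisticGrad A (s j.succ) j - logisticGrad A v j) * (γ j - v j) ≤
        L * d * (C * √Δ) := by
      refine (le_abs_self _).trans ?_
      rw [abs_mul]
      refine mul_le_mul ((hgrad _ _ j).trans (mul_le_mul_of_nonneg_left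
        (norm_sub_last_le_of_cycle hs j) hL)) ((norm_le_pi_norm (γ - v) j).trans hγ)
        (abs_nonneg _) (by positivity)
    linarith
  have h3 : 0 ≤ c * ∑ i, (A *ᵥ (γ - v)) i ^ 2 :=
    mul_nonneg hc.le (Finset.sum_nonneg fun _ _ => sq_nonneg _)
  rw [Finset.sum_const, Finset.card_univ, Fintype.card_fin, nsmul_eq_mul] at h2
  have h4 : Δ ≤ p * (L * C) * d * √Δ := by
    rw [hγQ] at h1
    linarith
  have h5 : √Δ ≤ p * (L * C) * d := by
    rcases (Real.sqrt_nonneg Δ).eq_or_lt with h0 | h0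
    · rw [← h0]
      positivity
    · refine le_of_mul_le_mul_right ?_ h0
      rwa [Real.mul_self_sqrt hΔ0]
  have h6 := pow_le_pow_left₀ (Real.sqrt_nonneg _) h5 2
  rwa [Real.sq_sqrt hΔ0, mul_pow] at h6

theorem IsCCMSequence.exists_tendsto_isMin (hA : ∀ j, A.col j ≠ 0) (hlam : 0 < lam)
    {x : ℕ → Fin p → ℝ} (hx : IsCCMSequence (lassoLogistic A lam) x) :
    ∃ β₀ : Fin p → ℝ, Tendsto x atTop (𝓝 β₀) ∧
      ∀ β : Fin p → ℝ, lassoLogistic A lam β₀ ≤ lassoLogistic A lam β := by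
  obtain ⟨s, hs⟩ := hx
  have hcont := continuous_lassoLogistic A (lam := lam)
  obtain ⟨βs, -, hmin'⟩ := exists_isMinOn_of_bounded_sublevel hcont isClosed_univ
    (Set.mem_univ (x 0)) fun β _ hβ => norm_le_of_lassoLogistic_le hlam hβ
  have hmin : ∀ β, lassoLogistic A lam βs ≤ lassoLogistic A lam β := fun β =>
    hmin' β (Set.mem_univ β)
  obtain ⟨c, hc, hdec⟩ := exists_cycle_decrease hA hlam (lassoLogistic A lam (x 0))
  obtain ⟨K, hK, hgap⟩ := exists_cycle_gap_bound hlam hmin (lassoLogistic A lam (x 0))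
  have hanti : Antitone fun r => lassoLogistic A lam (x r) := by
    refine antitone_nat_of_succ_le fun r => ?_
    rw [← (hs r).1, (hs r).2.2]
    exact antitone_of_cycle (hs r).2.1 (Fin.zero_le _)
  have hT : ∀ r, lassoLogistic A lam (x r) ≤ lassoLogistic A lam (x 0) := fun r =>
    hanti (Nat.zero_le r)
  have hstep : ∀ r, c * ‖x (r + 1) - x r‖ ^ 2 ≤
      lassoLogistic A lam (x r) - lassoLogistic A lam (x (r + 1)) := by
    intro r
    have := hdec (s r) (hs r).2.1 (by rw [(hs r).1]; exact hT r)
    rwa [(hs r).1, ← (hs r).2.2] at this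
  have hres : ∀ r, lassoLogistic A lam (x (r + 1)) - lassoLogistic A lam βs ≤
      K * ‖x (r + 1) - x r‖ ^ 2 := by
    intro r
    have := hgap (s r) (hs r).2.1 (by rw [(hs r).1]; exact hT r)
    rwa [(hs r).1, ← (hs r).2.2] at this
  set Δ : ℕ → ℝ := fun r => lassoLogistic A lam (x r) - lassoLogistic A lam βs with hΔ
  have hΔ0 : ∀ r, 0 ≤ Δ r := fun r => sub_nonneg.2 (hmin _)
  set ρ : ℝ := K / (c + K) with hρ
  have hρ0 : 0 ≤ ρ := by positivity
  have hρ1 : ρ < 1 := by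
    rw [hρ, div_lt_one (by positivity)]
    linarith
  have hcontr : ∀ r, Δ (r + 1) ≤ ρ * Δ r := by
    intro r
    have h1 := mul_le_mul_of_nonneg_left (hres r) hc.le
    have h2 := mul_le_mul_of_nonneg_left (hstep r) hK
    rw [hρ, div_mul_eq_mul_div, le_div_iff₀ (by positivity)]
    simp only [hΔ]
    nlinarith
  have hgeom : ∀ r, Δ r ≤ Δ 0 * ρ ^ r := by
    intro r
    induction r with
    | zero => simp
    | succ r ih =>
      have := mul_le_mul_of_nonneg_left ih hρ0
      rw [pow_succ]
      linarith [hcontr r]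
  have hcauchy : CauchySeq x := by
    refine cauchySeq_of_le_geometric (√ρ) (√(Δ 0 / c)) ?_ fun r => ?_
    · rwa [Real.sqrt_lt' one_pos, one_pow]
    · rw [dist_comm, dist_eq_norm]
      refine (sq_le_sq₀ (norm_nonneg _) (by positivity)).1 ?_
      rw [mul_pow, Real.sq_sqrt (div_nonneg (hΔ0 0) hc.le), ← pow_mul, mul_comm r 2, pow_mul,
        Real.sq_sqrt hρ0, div_mul_eq_mul_div, le_div_iff₀ hc]
      have h1 := hstep r
      have h2 := hmin (x (r + 1))
      have h3 := hgeom r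
      simp only [hΔ] at h3 ⊢
      linarith
  obtain ⟨β₀, hβ₀⟩ := cauchySeq_tendsto_of_complete hcauchy
  refine ⟨β₀, hβ₀, fun β => le_trans ?_ (hmin β)⟩
  have hlim : Tendsto (fun r => Δ 0 * ρ ^ r) atTop (𝓝 (Δ 0 * 0)) :=
    (tendsto_pow_atTop_nhds_zero_of_lt_one hρ0 hρ1).const_mul _
  rw [mul_zero] at hlim
  have hlimΔ : Tendsto Δ atTop (𝓝 (lassoLogistic A lam β₀ - lassoLogistic A lam βs)) :=
    ((hcont.tendsto β₀).comp hβ₀).sub_const _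
  exact sub_nonpos.1 (le_of_tendsto_of_tendsto' hlimΔ hlim hgeom)

end

lemma Qlogit_eq_lassoLogistic {N p : ℕ} (z : Fin N → (Fin p → ℝ)) (y : Fin N → ℝ) (lam : ℝ) :
    Qlogit z y lam = lassoLogistic (Matrix.of fun i j => y i * z i j) lam := by
  funext β
  have h : ∀ i, ((Matrix.of fun i j => y i * z i j) *ᵥ β) i = y i * (β ⬝ᵥ z i) := by
    intro i
    simp only [Matrix.mulVec, dotProduct, Matrix.of_apply, Finset.mul_sum]
    exact Finset.sum_congr rfl fun j _ => by ring
  simp only [Qlogit, lassoLogistic, logisticSum, logisticLoss, h]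

theorem theorem5p2 {N p : ℕ} (z : Fin N → (Fin p → ℝ)) (y : Fin N → ℝ)
    (hy : ∀ i, y i = 1 ∨ y i = -1) (lam : ℝ) (hlam : 0 < lam)
    (hX : ∀ j : Fin p, (designMatrix z).col j ≠ 0) :
    (∀ (β : Fin p → ℝ) (j : Fin p), ∃! v : Fin p → ℝ, IsCoordArgmin (Qlogit z y lam) j β v) ∧
    ∀ x : ℕ → (Fin p → ℝ), IsCCMSequence (Qlogit z y lam) x →
      ∃ βstar : Fin p → ℝ, Tendsto x atTop (𝓝 βstar) ∧
        ∀ β : Fin p → ℝ, Qlogit z y lam βstar ≤ Qlogit z y lam β := by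
  have hA : ∀ j, (Matrix.of fun i j => y i * z i j).col j ≠ 0 := by
    intro j
    obtain ⟨i, hi⟩ := Function.ne_iff.1 (hX j)
    have hyi : y i ≠ 0 := by rcases hy i with h | h <;> simp [h]
    exact Function.ne_iff.2 ⟨i, mul_ne_zero hyi hi⟩
  rw [Qlogit_eq_lassoLogistic]
  exact ⟨existsUnique_isCoordArgmin hA hlam, fun x hx => hx.exists_tendsto_isMin hA hlam⟩
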